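/- For integers $a,b,k\ge 0$ and $i\in\mathbb Z$ let $\Gamma_i^{[a;\,b]\times k}$ be the number of $(a+b)\times k$ matrices $\left[{A\over B}\right]$ over $\mathbb F_2$ of rank $i$ such that $A$ is a persymmetric $a\times k$ matrix and $B$ is a persymmetric $b\times k$ matrix (a matrix $[\alpha_{p,q}]$ is persymmetric if $\alpha_{p,q}=\alpha_{u,v}$ whenever $p+q=u+v$); in particular it is $0$ for $i<0$. Let $\mathbb K=\mathbb F_2((T^{-1}))$, $\mathbb P=\{\sum_{n\ge1}\alpha_nT^{-n}\}\subset\mathbb K$ and $\mathbb P_j=\{\sum_{n> j}\alpha_nT^{-n}\}$. For $t=\sum_{n\ge1}\alpha_nT^{-n}$ and $\eta=\sum_{n\ge1}\beta_nT^{-n}$ in $\mathbb P$ let $D^{[a;\,b]\times k}(t,\eta)$ be the matrix $\left[{A\over B}\right]$ with $A=(\alpha_{p+q-1})_{1\le p\le a,\,1\le q\le k}$ and $B=(\beta_{p+q-1})_{1\le p\le b,\,1\le q\le k}$. Let $s\ge2$, $m\ge0$, $k\ge1$. For $i\in\mathbb Z$ let $\sigma_{i,i,i}$ be the number of pairs $(t,\eta)\in\mathbb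 P/\mathbb P_{k+s-1}\times\mathbb P/\mathbb P_{k+s+m-1}$ with $$\operatorname{rank}D^{[s-1;\,s+m-1]\times k}(t,\eta)=\operatorname{rank}D^{[s;\,s+m-1]\times k}(t,\eta)=\operatorname{rank}D^{[s;\,s+m]\times k}(t,\eta)=i,$$ and put $\Delta_i=\sigma_{i,i,i}-3\,\sigma_{i-1,i-1,i-1}+2\,\sigma_{i-2,i-2,i-2}$. (1) (Recurrence.) For $0\le i\le\min(2s+m,k)$, $$\Gamma_i^{[s;\,s+m]\times k}=2\,\Gamma_{i-1}^{[s-1;\,s+m]\times k}+4\,\Gamma_{i-1}^{[s;\,s+m-1]\times k}-8\,\Gamma_{i-2}^{[s-1;\,s+m-1]\times k}+\Delta_i .$$ In (2) and (3) write $g_j=\Gamma_j^{[s-1;\,s+m-1]\times j}$. (2) If $1\le k\le 2s+m-2$, then $\sigma_{0,0,0}=1$, $\sigma_{i,i,i}=4g_i-g_{i+1}$ for $1\le i\le k-1$, and $\sigma_{k,k,k}=4g_k$. If $k\ge2s+m-2$, then $\sigma_{0,0,0}=1$, $\sigma_{i,i,i}=4g_i-g_{i+1}$ for $1\le i\le2s+m-3$,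 and $\sigma_{i,i,i}=4g_i$ for $i=2s+m-2$. (3) The remainder $\Delta_i$ equals $$\begin{cases} 1 & i=0,\\ 4g_1-g_2-3 & i=1,\ k\ge2,\\ 4g_1-3 & i=1,\ k=1,\\ 7g_2-12g_1-g_3+2 & i=2,\ k\ge3,\\ 7g_2-12g_1+2 & i=2,\ k=2,\\ 7g_i-14g_{i-1}+8g_{i-2}-g_{i+1} & 3\le i\le2s+m-3,\ k\ge i+1,\\ 7g_i-14g_{i-1}+8g_{i-2} & 3\le i\le2s+m-3,\ k=i,\\ 7g_{2s+m-2}-14g_{2s+m-3}+8g_{2s+m-4} & i=2s+m-2,\ k\ge i,\\ -14g_{2s+m-2}+8g_{2s+m-3} & i=2s+m-1,\ k\ge i,\\ 8g_{2s+m-2} & i=2s+m,\ k\ge i \end{cases}$$ (where several lines apply, all of them hold). -/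

import Mathlib

open scoped LaurentSeries

/-- A matrix `[α_{i,j}]` is persymmetric if `α_{i,j} = α_{r,s}` whenever `i + j = r + s`. -/
def IsPersymmetric {a k : ℕ} (A : Matrix (Fin a) (Fin k) (ZMod 2)) : Prop :=
  ∀ (i r : Fin a) (j s : Fin k), (i : ℕ) + j = r + s → A i j = A r s

/-- The set of double persymmetric matrices `[A / B]` over `𝔽₂` of rank `i`, where the upper
block `A` is a persymmetric `a × k` matrix and the lower block `B` is a persymmetric `b × k`
matrix. The rank index `i` is an integer, so that the set is empty for negative `i`. -/
def doublePersymmetricOfRank (a b k : ℕ) (i : ℤ) :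
    Set (Matrix (Fin a ⊕ Fin b) (Fin k) (ZMod 2)) :=
  {M | IsPersymmetric M.toRows₁ ∧ IsPersymmetric M.toRows₂ ∧ (M.rank : ℤ) = i}

/-- `Γ_i^{[a over b] × k}`, the number of double persymmetric matrices of rank `i`. -/
noncomputable def Gam (a b k : ℕ) (i : ℤ) : ℤ :=
  ((doublePersymmetricOfRank a b k i).ncard : ℤ)

/-- `Γ_j^{[s-1 over s-1+m] × j}`, the number of double persymmetric matrices with `j` columns that
have rank `j`. -/
noncomputable def GamSq (s m j : ℕ) : ℤ := Gam (s - 1) (s + m - 1) j j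

/-- The field `𝕂 = 𝔽₂((T⁻¹))`; the variable of the Laurent series stands for `T⁻¹`, so that
`t.coeff n` is the coefficient of `T⁻ⁿ` in `t`. -/
abbrev KK : Type := (ZMod 2)⸨X⸩

/-- `ℙ_j = {t ∈ 𝕂 : t = ∑_{n > j} α_n T⁻ⁿ}`. -/
def PP (j : ℕ) : AddSubgroup KK where
  carrier := {t | ∀ n : ℤ, n ≤ j → t.coeff n = 0}
  zero_mem' := fun _ _ => rfl
  add_mem' := by
    intro t u ht hu n hn
    simp [ht n hn, hu n hn]
  neg_mem' := by
    intro t ht n hn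
    simp [ht n hn]

/-- The unit interval `ℙ = {t ∈ 𝕂 : t = ∑_{n ≥ 1} α_n T⁻ⁿ}` of `𝕂`. -/
abbrev UnitInterval : AddSubgroup KK := PP 0

/-- The quotient group `ℙ / ℙ_j`. -/
abbrev PQuot (j : ℕ) : Type := UnitInterval ⧸ (PP j).addSubgroupOf UnitInterval

/-- For `t = ∑ α_n T⁻ⁿ` in `ℙ`, the persymmetric `a × k` matrix with entry `α_{i+j-1}` at row `i`
and column `j`, counted from `1`. -/
def persymMatrix (a k : ℕ) (t : UnitInterval) : Matrix (Fin a) (Fin k) (ZMod 2) :=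
  Matrix.of fun i j => (t : KK).coeff ((i : ℤ) + j + 1)

/-- The double persymmetric matrix `D^{[a over b] × k}(t, η)`. -/
def DD (a b k : ℕ) (t η : UnitInterval) : Matrix (Fin a ⊕ Fin b) (Fin k) (ZMod 2) :=
  Matrix.fromRows (persymMatrix a k t) (persymMatrix b k η)

/-- The set of `(t, η) ∈ ℙ/ℙ_{k+s-1} × ℙ/ℙ_{k+s+m-1}` for which the three nested matrices
`D^{[s-1 over s+m-1] × k}(t, η)`, `D^{[s over s+m-1] × k}(t, η)` and `D^{[s over s+m] × k}(t, η)`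
all have rank `i`. For `s, k ≥ 1` the three matrices only involve `α_1, …, α_{k+s-1}` and
`β_1, …, β_{k+s+m-1}`, so the condition does not depend on the choice of representatives
(see `DD_congr`). -/
def sigSet (s m k : ℕ) (i : ℤ) : Set (PQuot (k + s - 1) × PQuot (k + s + m - 1)) :=
  {x | ∃ t η : UnitInterval,
    x = ((QuotientAddGroup.mk t : PQuot (k + s - 1)),
      (QuotientAddGroup.mk η : PQuot (k + s + m - 1))) ∧
    ((DD (s - 1) (s + m - 1) k t η).rank : ℤ) = i ∧
    ((DD s (s + m - 1) k t η).rank : ℤ) = i ∧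
    ((DD s (s + m) k t η).rank : ℤ) = i}

/-- The number `σ_{i,i,i}` of elements of the preceding set (zero for negative `i`). -/
noncomputable def sig (s m k : ℕ) (i : ℤ) : ℤ := ((sigSet s m k i).ncard : ℤ)

/-- The remainder `Δ_i^{[s over s+m] × k} = σ_{i,i,i} - 3 σ_{i-1,i-1,i-1} + 2 σ_{i-2,i-2,i-2}`. -/
noncomputable def Del (s m k : ℕ) (i : ℤ) : ℤ :=
  sig s m k i - 3 * sig s m k (i - 1) + 2 * sig s m k (i - 2)

/-- The entries of `persymMatrix a k t` depend only on the class of `t` in `ℙ/ℙ_j`, if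
`a + k - 1 ≤ j`. -/
theorem persymMatrix_congr {a k j : ℕ} (h : a + k ≤ j + 1) {t t' : UnitInterval}
    (ht : (QuotientAddGroup.mk t : PQuot j) = QuotientAddGroup.mk t') :
    persymMatrix a k t = persymMatrix a k t' := by
  have h1 : ∀ n : ℤ, n ≤ j → (-(t : KK) + (t' : KK)).coeff n = 0 :=
    AddSubgroup.mem_addSubgroupOf.1 (QuotientAddGroup.eq.1 ht)
  ext x y
  have hx := x.2
  have hy := y.2
  have h2 := h1 ((x : ℤ) + y + 1) (by omega)
  rw [HahnSeries.coeff_add, HahnSeries.coeff_neg] at h2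
  exact (neg_add_eq_zero.1 h2)

theorem DD_congr {a b k j l : ℕ} (ha : a + k ≤ j + 1) (hb : b + k ≤ l + 1)
    {t t' η η' : UnitInterval}
    (ht : (QuotientAddGroup.mk t : PQuot j) = QuotientAddGroup.mk t')
    (hη : (QuotientAddGroup.mk η : PQuot l) = QuotientAddGroup.mk η') :
    DD a b k t η = DD a b k t' η' := by
  unfold DD
  rw [persymMatrix_congr ha ht, persymMatrix_congr hb hη]

/-!
A class in `ℙ/ℙ_j` and a persymmetric matrix are both nothing but a finite sequence over `𝔽₂`, so
all the numbers in question count pairs of sequences `(α, β)`, with `a = s - 1` and `b = s + m - 1`,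
according to the ranks of pairs of Hankel matrices (`Gam_eq_seqCount`, `sig_eq_stableCount`). A row
more in a block of a matrix with fixed number of columns costs one more term of a sequence; a matrix
with one row less is counted twice for each free last term.

*The recurrence.* Let `V` be the row space for `a` and `b` rows, and let `u`, `v` be the next rows of
the two blocks. Sorting the pairs by which of `u`, `v` and `u + v` lie in `V` and comparing the ranks
of `V`, `V + ⟨u⟩`, `V + ⟨v⟩` and `V + ⟨u, v⟩` (`rank_indicator_identity`), one finds that, apart
from the pairs with `u, v ∈ V`, which make up the remainder, only two kinds of pairs do not cancel:
those with `u ∈ V`, `v ∉ V`, and those with `u + v ∈ V`, `v ∉ V`. The map `α_n ↦ α_n + β_{n+m}` is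
an involution that preserves `V` and `v` and sends `u` to `u + v`, so that the two kinds are equally
frequent (`seqCount_window_add`).

*The stable pairs.* Suppose that `u, v ∈ V` and that the rank `i` is less than the number `k` of
columns. Write a linear relation between the columns as a polynomial of degree less than `k`. Since
the additional rows impose no new condition, `X * C` is a relation whenever `C` is one and the degree
permits. By dimension there is then no relation of degree less than `i`, and there is a monic one,
`P`, of degree `i` (`rank_initial_columns`): the first `i` columns are independent, and `P` is a
linear recurrence satisfied by all the terms of both sequences (`exists_recurrence_of_stable`).
Conversely such a recurrence continues the first `i + 1` columns uniquely to a stable pair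
(`stableCount_eq_seqCount_initial`). The pairs to be counted are therefore those for which the first
`i` columns have rank `i`, `4 g_i` in number as both sequences have a free last term there, except
those for which the first `i + 1` columns have rank `i + 1`, which are `g_{i+1}` in number. For
`k = i` there is nothing to subtract, and `g_{i+1} = 0` if `i + 1` exceeds the number of rows. The
values of the remainder follow by substitution.
-/

/-! ### Pairs of Hankel matrices and their row spaces -/

/-- The matrix of `k` columns whose upper block is the `a`-rowed Hankel matrix of the sequence `p.1`
and whose lower block is the `b`-rowed Hankel matrix of `p.2`. Sequences are indexed from `0`, so
that the entry `α_{i+j-1}` of the persymmetric matrix becomes `p.1 (i + j)` for `i` and `j` counted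
from `0`. -/
def pairMatrix {R : Type*} (a b k : ℕ) (p : (ℕ → R) × (ℕ → R)) :
    Matrix (Fin a ⊕ Fin b) (Fin k) R :=
  Matrix.fromRows (Matrix.of fun i j => p.1 (i + j)) (Matrix.of fun i j => p.2 (i + j))

/-- The matrix depends only on the first `a + k - 1` and `b + k - 1` terms of the sequences. -/
theorem pairMatrix_congr {R : Type*} {a b k : ℕ} {p q : (ℕ → R) × (ℕ → R)}
    (h₁ : ∀ n, n + 1 < a + k → p.1 n = q.1 n) (h₂ : ∀ n, n + 1 < b + k → p.2 n = q.2 n) :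
    pairMatrix a b k p = pairMatrix a b k q := by
  ext (i | i) j
  · exact h₁ _ (by omega)
  · exact h₂ _ (by omega)

section RowSpace

variable {F : Type*} [Field F]

/-- The `k` consecutive terms `α i, …, α (i + k - 1)`, a row of the Hankel matrix of `α`. -/
def window (k : ℕ) (α : ℕ → F) (i : ℕ) : Fin k → F := fun j => α (i + j)

/-- The row space of `pairMatrix a b k p`. -/
def rowSpace (a b k : ℕ) (p : (ℕ → F) × (ℕ → F)) : Submodule F (Fin k → F) :=
  Submodule.span F (window k p.1 '' Set.Iio a ∪ window k p.2 '' Set.Iio b)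

theorem rank_pairMatrix (a b k : ℕ) (p : (ℕ → F) × (ℕ → F)) :
    (pairMatrix a b k p).rank = Module.finrank F (rowSpace a b k p) := by
  suffices h : Set.range (pairMatrix a b k p).row
      = window k p.1 '' Set.Iio a ∪ window k p.2 '' Set.Iio b by
    rw [Matrix.rank_eq_finrank_span_row, rowSpace, h]
  ext v
  simp only [Set.mem_range, Sum.exists, Set.mem_union, Set.mem_image, Set.mem_Iio]
  refine or_congr ⟨?_, ?_⟩ ⟨?_, ?_⟩
  · rintro ⟨i, rfl⟩; exact ⟨i, i.2, rfl⟩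
  · rintro ⟨i, hi, rfl⟩; exact ⟨⟨i, hi⟩, rfl⟩
  · rintro ⟨i, rfl⟩; exact ⟨i, i.2, rfl⟩
  · rintro ⟨i, hi, rfl⟩; exact ⟨⟨i, hi⟩, rfl⟩

theorem rowSpace_succ_left (a b k : ℕ) (p : (ℕ → F) × (ℕ → F)) :
    rowSpace (a + 1) b k p = rowSpace a b k p ⊔ Submodule.span F {window k p.1 a} := by
  rw [rowSpace, ← Order.succ_eq_add_one, Order.Iio_succ_eq_insert, Set.image_insert_eq,
    Set.insert_union, Submodule.span_insert, sup_comm, rowSpace]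

theorem rowSpace_succ_right (a b k : ℕ) (p : (ℕ → F) × (ℕ → F)) :
    rowSpace a (b + 1) k p = rowSpace a b k p ⊔ Submodule.span F {window k p.2 b} := by
  rw [rowSpace, ← Order.succ_eq_add_one, Order.Iio_succ_eq_insert, Set.image_insert_eq,
    Set.union_insert, Submodule.span_insert, sup_comm, rowSpace]

theorem finrank_sup_span_singleton_of_mem {k : ℕ} {V : Submodule F (Fin k → F)} {u : Fin k → F}
    (hu : u ∈ V) : Module.finrank F ↥(V ⊔ Submodule.span F {u}) = Module.finrank F V := by
  rw [sup_eq_left.2 ((Submodule.span_singleton_le_iff_mem u V).2 hu)]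

/-- Replacing `α_n` by `α_n + β_{n+m}` adds to each row of the upper block the row of the lower block
that lies `m` places further down. -/
def shear (m : ℕ) (p : (ℕ → F) × (ℕ → F)) : (ℕ → F) × (ℕ → F) :=
  (fun n => p.1 n + p.2 (n + m), p.2)

theorem window_shear_fst (m k i : ℕ) (p : (ℕ → F) × (ℕ → F)) :
    window k (shear m p).1 i = window k p.1 i + window k p.2 (i + m) := by
  funext j
  simp only [window, shear, Pi.add_apply]
  rw [Nat.add_right_comm i m]

theorem shear_shear [CharP F 2] (m : ℕ) (p : (ℕ → F) × (ℕ → F)) : shear m (shear m p) = p := by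
  refine Prod.ext (funext fun n => ?_) rfl
  simp only [shear, add_assoc, CharTwo.add_self_eq_zero, add_zero]

theorem rowSpace_shear_le {a b m : ℕ} (h : a + m ≤ b) (k : ℕ) (p : (ℕ → F) × (ℕ → F)) :
    rowSpace a b k (shear m p) ≤ rowSpace a b k p := by
  rw [rowSpace, Submodule.span_le]
  have hβ : ∀ j < b, window k p.2 j ∈ rowSpace a b k p := fun j hj =>
    Submodule.subset_span (Or.inr ⟨j, hj, rfl⟩)
  rintro _ (⟨i, hi, rfl⟩ | ⟨i, hi, rfl⟩)
  · have hi' : i < a := hi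
    rw [window_shear_fst]
    exact Submodule.add_mem _ (Submodule.subset_span (Or.inl ⟨i, hi, rfl⟩)) (hβ _ (by omega))
  · exact hβ i hi

theorem rowSpace_shear [CharP F 2] {a b m : ℕ} (h : a + m ≤ b) (k : ℕ) (p : (ℕ → F) × (ℕ → F)) :
    rowSpace a b k (shear m p) = rowSpace a b k p := by
  refine le_antisymm (rowSpace_shear_le h k p) ?_
  conv_lhs => rw [← shear_shear m p]
  exact rowSpace_shear_le h k _

end RowSpace

/-! ### Counting pairs of finite sequences -/

section Count

theorem finite_setOf_eq_zero_of_le (L : ℕ) :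
    {α : ℕ → ZMod 2 | ∀ n, L ≤ n → α n = 0}.Finite := by
  refine Set.Finite.of_finite_image (f := fun α (i : Fin L) => α i) (Set.toFinite _) ?_
  intro α hα β hβ h
  funext n
  by_cases hn : n < L
  · exact congrFun h ⟨n, hn⟩
  · rw [hα n (by omega), hβ n (by omega)]

/-- The pairs of sequences over `𝔽₂` of lengths `L` and `L'`, encoded as sequences that vanish from
the index `L`, respectively `L'`, onwards. -/
noncomputable def seqBox (L L' : ℕ) : Finset ((ℕ → ZMod 2) × (ℕ → ZMod 2)) :=
  ((finite_setOf_eq_zero_of_le L).prod (finite_setOf_eq_zero_of_le L')).toFinset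

theorem mem_seqBox {L L' : ℕ} {p : (ℕ → ZMod 2) × (ℕ → ZMod 2)} :
    p ∈ seqBox L L' ↔ (∀ n, L ≤ n → p.1 n = 0) ∧ ∀ n, L' ≤ n → p.2 n = 0 := by
  simp [seqBox]

theorem eq_of_mem_seqBox {L L' : ℕ} {p q : (ℕ → ZMod 2) × (ℕ → ZMod 2)} (hp : p ∈ seqBox L L')
    (hq : q ∈ seqBox L L') (h₁ : ∀ n < L, p.1 n = q.1 n) (h₂ : ∀ n < L', p.2 n = q.2 n) :
    p = q := by
  rw [mem_seqBox] at hp hq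
  refine Prod.ext (funext fun n => ?_) (funext fun n => ?_)
  · by_cases hn : n < L
    · exact h₁ n hn
    · rw [hp.1 n (by omega), hq.1 n (by omega)]
  · by_cases hn : n < L'
    · exact h₂ n hn
    · rw [hp.2 n (by omega), hq.2 n (by omega)]

open Classical in
/-- The number of pairs of sequences of lengths `L` and `L'` with the property `Q`. -/
noncomputable def seqCount (L L' : ℕ) (Q : (ℕ → ZMod 2) × (ℕ → ZMod 2) → Prop) : ℤ :=
  (((seqBox L L').filter Q).card : ℤ)

open Classical in
theorem seqCount_eq_sum (L L' : ℕ) (Q : (ℕ → ZMod 2) × (ℕ → ZMod 2) → Prop) :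
    seqCount L L' Q = ∑ p ∈ seqBox L L', if Q p then 1 else 0 := by
  rw [seqCount, Finset.card_filter]
  push_cast
  rfl

theorem seqCount_congr {L L' : ℕ} {Q Q' : (ℕ → ZMod 2) × (ℕ → ZMod 2) → Prop}
    (h : ∀ p ∈ seqBox L L', Q p ↔ Q' p) : seqCount L L' Q = seqCount L L' Q' := by
  classical
  rw [seqCount, seqCount, Finset.filter_congr h]

theorem seqCount_eq_ncard (L L' : ℕ) (Q : (ℕ → ZMod 2) × (ℕ → ZMod 2) → Prop) :
    seqCount L L' Q = ({p | p ∈ seqBox L L' ∧ Q p}.ncard : ℤ) := by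
  classical
  rw [seqCount, ← Set.ncard_coe_finset, Finset.coe_filter]

theorem seqCount_eq_of_bijOn {L L' M M' : ℕ} {Q R : (ℕ → ZMod 2) × (ℕ → ZMod 2) → Prop}
    (f : (ℕ → ZMod 2) × (ℕ → ZMod 2) → (ℕ → ZMod 2) × (ℕ → ZMod 2))
    (hf : Set.BijOn f {p | p ∈ seqBox L L' ∧ Q p} {p | p ∈ seqBox M M' ∧ R p}) :
    seqCount L L' Q = seqCount M M' R := by
  rw [seqCount_eq_ncard, seqCount_eq_ncard, ← hf.image_eq, hf.injOn.ncard_image]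

/-- A property that ignores the last term of the first sequence is counted twice for each pair with
that term left out. -/
theorem seqCount_succ_left {L L' : ℕ} {Q : (ℕ → ZMod 2) × (ℕ → ZMod 2) → Prop}
    (hQ : ∀ p q : (ℕ → ZMod 2) × (ℕ → ZMod 2), (∀ n < L, p.1 n = q.1 n) → p.2 = q.2 → Q p → Q q) :
    seqCount (L + 1) L' Q = 2 * seqCount L L' Q := by
  have himg : {p | p ∈ seqBox (L + 1) L' ∧ Q p} =
      (fun x : ((ℕ → ZMod 2) × (ℕ → ZMod 2)) × ZMod 2 => (Function.update x.1.1 L x.2, x.1.2)) ''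
        ({p | p ∈ seqBox L L' ∧ Q p} ×ˢ Set.univ) := by
    ext p
    constructor
    · rintro ⟨hp, hq⟩
      rw [mem_seqBox] at hp
      refine ⟨((Function.update p.1 L 0, p.2), p.1 L), ⟨⟨mem_seqBox.2 ⟨fun n hn => ?_, hp.2⟩, ?_⟩,
        Set.mem_univ _⟩, ?_⟩
      · rcases eq_or_ne n L with rfl | hne
        · simp
        · simpa [hne] using hp.1 n (by omega)
      · exact hQ p _ (fun n hn => by simp [hn.ne]) rfl hq
      · simp
    · rintro ⟨⟨q, x⟩, ⟨⟨hp, hq⟩, -⟩, rfl⟩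
      rw [mem_seqBox] at hp
      refine ⟨mem_seqBox.2 ⟨fun n hn => ?_, hp.2⟩, hQ q _ (fun n hn => by simp [hn.ne]) rfl hq⟩
      have hne : n ≠ L := by omega
      simpa [hne] using hp.1 n (by omega)
  rw [seqCount_eq_ncard, seqCount_eq_ncard, himg, Set.InjOn.ncard_image, Set.ncard_prod,
    Set.ncard_univ, Nat.card_zmod, mul_comm]
  · push_cast; rfl
  · rintro ⟨p, x⟩ ⟨⟨hp, -⟩, -⟩ ⟨q, y⟩ ⟨⟨hq, -⟩, -⟩ h
    rw [mem_seqBox] at hp hq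
    simp only [Prod.mk.injEq] at h
    have h1 := fun n => congrFun h.1 n
    refine Prod.ext (Prod.ext (funext fun n => ?_) h.2) (by simpa using h1 L)
    rcases eq_or_ne n L with rfl | hne
    · exact (hp.1 n le_rfl).trans (hq.1 n le_rfl).symm
    · simpa [hne] using h1 n

theorem seqCount_swap (L L' : ℕ) (Q : (ℕ → ZMod 2) × (ℕ → ZMod 2) → Prop) :
    seqCount L L' Q = seqCount L' L fun p => Q p.swap := by
  refine seqCount_eq_of_bijOn Prod.swap ⟨?_, Prod.swap_injective.injOn, ?_⟩
  · rintro p ⟨hp, hq⟩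
    exact ⟨mem_seqBox.2 (mem_seqBox.1 hp).symm, hq⟩
  · rintro p ⟨hp, hq⟩
    exact ⟨p.swap, ⟨mem_seqBox.2 (mem_seqBox.1 hp).symm, hq⟩, rfl⟩

theorem seqCount_succ_right {L L' : ℕ} {Q : (ℕ → ZMod 2) × (ℕ → ZMod 2) → Prop}
    (hQ : ∀ p q : (ℕ → ZMod 2) × (ℕ → ZMod 2), p.1 = q.1 → (∀ n < L', p.2 n = q.2 n) → Q p → Q q) :
    seqCount L (L' + 1) Q = 2 * seqCount L L' Q := by
  rw [seqCount_swap, seqCount_succ_left fun p q h1 h2 => hQ _ _ h2 h1, ← seqCount_swap]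

theorem seqCount_succ_left_rank {a b k : ℕ} (L' : ℕ) (hk : 1 ≤ k) (i : ℤ) :
    seqCount (k + a) L' (fun p => ((pairMatrix a b k p).rank : ℤ) = i)
      = 2 * seqCount (k + a - 1) L' (fun p => ((pairMatrix a b k p).rank : ℤ) = i) := by
  obtain ⟨k, rfl⟩ := Nat.exists_eq_add_of_le' hk
  rw [show k + 1 + a = (k + a) + 1 by omega, Nat.add_sub_cancel]
  refine seqCount_succ_left fun p q h1 h2 h => ?_
  rw [← h, pairMatrix_congr (fun n hn => (h1 n (by omega)).symm) fun n _ => by rw [h2]]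

theorem seqCount_succ_right_rank {a b k : ℕ} (L : ℕ) (hk : 1 ≤ k) (i : ℤ) :
    seqCount L (k + b) (fun p => ((pairMatrix a b k p).rank : ℤ) = i)
      = 2 * seqCount L (k + b - 1) (fun p => ((pairMatrix a b k p).rank : ℤ) = i) := by
  obtain ⟨k, rfl⟩ := Nat.exists_eq_add_of_le' hk
  rw [show k + 1 + b = (k + b) + 1 by omega, Nat.add_sub_cancel]
  refine seqCount_succ_right fun p q h1 h2 h => ?_
  rw [← h, pairMatrix_congr (fun n _ => by rw [h1]) fun n hn => (h2 n (by omega)).symm]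

end Count

/-! ### The recurrence -/

section Recurrence

theorem mem_sup_span_singleton_zmod_two {k : ℕ} {V : Submodule (ZMod 2) (Fin k → ZMod 2)}
    {u v : Fin k → ZMod 2} :
    v ∈ V ⊔ Submodule.span (ZMod 2) {u} ↔ v ∈ V ∨ u + v ∈ V := by
  rw [Submodule.mem_sup]
  constructor
  · rintro ⟨x, hx, y, hy, rfl⟩
    obtain ⟨c, rfl⟩ := Submodule.mem_span_singleton.1 hy
    rcases (by decide : ∀ c : ZMod 2, c = 0 ∨ c = 1) c with rfl | rfl
    · left; simpa using hx
    · right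
      rwa [one_smul, add_left_comm, ZModModule.add_self, add_zero]
  · rintro (h | h)
    · exact ⟨v, h, 0, zero_mem _, add_zero v⟩
    · refine ⟨u + v, h, u, Submodule.mem_span_singleton_self u, ?_⟩
      rw [add_right_comm, ZModModule.add_self, zero_add]

open Classical in
/-- The effect on the rank of adjoining two rows `u` and `v` to the row space `V`. Apart from the
case where no rank grows, the indicators cancel, except when `v ∉ V` and exactly one of `u` and
`u + v` lies in `V`. -/
theorem rank_indicator_identity {k : ℕ} (V : Submodule (ZMod 2) (Fin k → ZMod 2))
    (u v : Fin k → ZMod 2) {r ru rv ruv : ℕ} (hr : r = Module.finrank (ZMod 2) V)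
    (hu : ru = Module.finrank (ZMod 2) ↥(V ⊔ Submodule.span (ZMod 2) {u}))
    (hv : rv = Module.finrank (ZMod 2) ↥(V ⊔ Submodule.span (ZMod 2) {v}))
    (huv : ruv = Module.finrank (ZMod 2)
      ↥(V ⊔ Submodule.span (ZMod 2) {u} ⊔ Submodule.span (ZMod 2) {v})) (i : ℤ) :
    (if (ruv : ℤ) = i then (1 : ℤ) else 0)
      = (if (rv : ℤ) = i - 1 then 1 else 0) + 2 * (if (ru : ℤ) = i - 1 then 1 else 0)
        - 2 * (if (r : ℤ) = i - 2 then 1 else 0)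
        + ((if (r : ℤ) = i ∧ (ru : ℤ) = i ∧ (ruv : ℤ) = i then 1 else 0)
          - 3 * (if (r : ℤ) = i - 1 ∧ (ru : ℤ) = i - 1 ∧ (ruv : ℤ) = i - 1 then 1 else 0)
          + 2 * (if (r : ℤ) = i - 2 ∧ (ru : ℤ) = i - 2 ∧ (ruv : ℤ) = i - 2 then 1 else 0))
        + ((if (u + v ∈ V ∧ v ∉ V) ∧ (r : ℤ) = i - 1 then 1 else 0)
          - (if (u ∈ V ∧ v ∉ V) ∧ (r : ℤ) = i - 1 then 1 else 0))
        - ((if (u + v ∈ V ∧ v ∉ V) ∧ (r : ℤ) = i - 2 then 1 else 0)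
          - (if (u ∈ V ∧ v ∉ V) ∧ (r : ℤ) = i - 2 then 1 else 0)) := by
  by_cases hA : u ∈ V <;> by_cases hB : v ∈ V
  · have hC : u + v ∈ V := V.add_mem hA hB
    rw [sup_eq_left.2 ((Submodule.span_singleton_le_iff_mem u V).2 hA),
      finrank_sup_span_singleton_of_mem hB] at huv
    rw [finrank_sup_span_singleton_of_mem hA] at hu
    rw [finrank_sup_span_singleton_of_mem hB] at hv
    obtain rfl : ru = r := by omega
    obtain rfl : rv = ru := by omega
    obtain rfl : ruv = rv := by omega
    simp only [hB, not_true_eq_false, and_false, false_and, if_false, and_self]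
    ring
  · have hC : u + v ∉ V := fun h => hB ((V.add_mem_iff_right hA).1 h)
    rw [sup_eq_left.2 ((Submodule.span_singleton_le_iff_mem u V).2 hA),
      Submodule.finrank_sup_span_singleton hB] at huv
    rw [finrank_sup_span_singleton_of_mem hA] at hu
    rw [Submodule.finrank_sup_span_singleton hB] at hv
    have e1 : (ruv : ℤ) = i ↔ (r : ℤ) = i - 1 := by omega
    have e2 : (rv : ℤ) = i - 1 ↔ (r : ℤ) = i - 2 := by omega
    have e3 : (ru : ℤ) = i - 1 ↔ (r : ℤ) = i - 1 := by omega
    have e4 : ∀ j : ℤ, ¬((r : ℤ) = j ∧ (ru : ℤ) = j ∧ (ruv : ℤ) = j) := by omega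
    simp only [e4, if_false]
    simp only [e1, e2, e3, hA, hB, hC, not_false_eq_true, and_self, true_and, false_and, if_false]
    ring
  · have hC : u + v ∉ V := fun h => hA ((V.add_mem_iff_left hB).1 h)
    rw [finrank_sup_span_singleton_of_mem (Submodule.mem_sup_left hB),
      Submodule.finrank_sup_span_singleton hA] at huv
    rw [Submodule.finrank_sup_span_singleton hA] at hu
    rw [finrank_sup_span_singleton_of_mem hB] at hv
    have e1 : (ruv : ℤ) = i ↔ (r : ℤ) = i - 1 := by omega
    have e2 : (rv : ℤ) = i - 1 ↔ (r : ℤ) = i - 1 := by omega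
    have e3 : (ru : ℤ) = i - 1 ↔ (r : ℤ) = i - 2 := by omega
    have e4 : ∀ j : ℤ, ¬((r : ℤ) = j ∧ (ru : ℤ) = j ∧ (ruv : ℤ) = j) := by omega
    simp only [e4, if_false]
    simp only [e1, e2, e3, hB, hC, not_true_eq_false, and_false, false_and, if_false]
    ring
  · rw [Submodule.finrank_sup_span_singleton hA] at hu
    rw [Submodule.finrank_sup_span_singleton hB] at hv
    by_cases hC : u + v ∈ V
    · rw [finrank_sup_span_singleton_of_mem (mem_sup_span_singleton_zmod_two.2 (Or.inr hC)),
        Submodule.finrank_sup_span_singleton hA] at huv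
      have e1 : (ruv : ℤ) = i ↔ (r : ℤ) = i - 1 := by omega
      have e2 : (rv : ℤ) = i - 1 ↔ (r : ℤ) = i - 2 := by omega
      have e3 : (ru : ℤ) = i - 1 ↔ (r : ℤ) = i - 2 := by omega
      have e4 : ∀ j : ℤ, ¬((r : ℤ) = j ∧ (ru : ℤ) = j ∧ (ruv : ℤ) = j) := by omega
      simp only [e4, if_false]
      simp only [e1, e2, e3, hA, hB, hC, not_false_eq_true, and_self, true_and, false_and, if_false]
      ring
    · rw [Submodule.finrank_sup_span_singleton
          (fun h => (mem_sup_span_singleton_zmod_two.1 h).elim hB hC),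
        Submodule.finrank_sup_span_singleton hA] at huv
      have e1 : (ruv : ℤ) = i ↔ (r : ℤ) = i - 2 := by omega
      have e2 : (rv : ℤ) = i - 1 ↔ (r : ℤ) = i - 2 := by omega
      have e3 : (ru : ℤ) = i - 1 ↔ (r : ℤ) = i - 2 := by omega
      have e4 : ∀ j : ℤ, ¬((r : ℤ) = j ∧ (ru : ℤ) = j ∧ (ruv : ℤ) = j) := by omega
      simp only [e4, if_false]
      simp only [e1, e2, e3, hA, hC, false_and, if_false]
      ring

/-- The shear by `m` leaves the row space `V` and the new row `v` of the lower block unchanged and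
exchanges the new row `u` of the upper block with `u + v`. -/
theorem seqCount_window_add (a m k : ℕ) (j : ℤ) :
    seqCount (k + a) (k + (a + m)) (fun p =>
        (window k p.1 a + window k p.2 (a + m) ∈ rowSpace a (a + m) k p ∧
          window k p.2 (a + m) ∉ rowSpace a (a + m) k p) ∧
        ((pairMatrix a (a + m) k p).rank : ℤ) = j)
      = seqCount (k + a) (k + (a + m)) (fun p =>
        (window k p.1 a ∈ rowSpace a (a + m) k p ∧
          window k p.2 (a + m) ∉ rowSpace a (a + m) k p) ∧
        ((pairMatrix a (a + m) k p).rank : ℤ) = j) := by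
  have hbox : ∀ p ∈ seqBox (k + a) (k + (a + m)), shear m p ∈ seqBox (k + a) (k + (a + m)) := by
    intro p hp
    rw [mem_seqBox] at hp ⊢
    refine ⟨fun n hn => ?_, hp.2⟩
    simp only [shear]
    rw [hp.1 n hn, hp.2 (n + m) (by omega), add_zero]
  have hsnd : ∀ p : (ℕ → ZMod 2) × (ℕ → ZMod 2), (shear m p).2 = p.2 := fun _ => rfl
  have hrow := fun p : (ℕ → ZMod 2) × (ℕ → ZMod 2) => rowSpace_shear (le_refl (a + m)) k p
  refine seqCount_eq_of_bijOn (shear m) ⟨?_, ?_, ?_⟩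
  · rintro p ⟨hp, hq⟩
    refine ⟨hbox p hp, ?_⟩
    rwa [rank_pairMatrix, hsnd, hrow, window_shear_fst, ← rank_pairMatrix]
  · exact (Function.Involutive.injective (shear_shear m)).injOn
  · rintro p ⟨hp, hq⟩
    refine ⟨shear m p, ⟨hbox p hp, ?_⟩, shear_shear m p⟩
    rwa [rank_pairMatrix, hsnd, hrow, window_shear_fst, ← rank_pairMatrix, add_assoc,
      ZModModule.add_self, add_zero]

/-- The number of pairs for which the rank `i` of the matrix with `a` and `b` rows stays the same
when a row is adjoined to the upper block, and then another to the lower block. -/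
noncomputable def stableCount (a b k : ℕ) (i : ℤ) : ℤ :=
  seqCount (k + a) (k + b) fun p => ((pairMatrix a b k p).rank : ℤ) = i ∧
    ((pairMatrix (a + 1) b k p).rank : ℤ) = i ∧ ((pairMatrix (a + 1) (b + 1) k p).rank : ℤ) = i

theorem seqCount_rank_recurrence (a m k : ℕ) (i : ℤ) :
    seqCount (k + a) (k + (a + m))
        (fun p => ((pairMatrix (a + 1) (a + m + 1) k p).rank : ℤ) = i)
      = seqCount (k + a) (k + (a + m))
          (fun p => ((pairMatrix a (a + m + 1) k p).rank : ℤ) = i - 1)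
        + 2 * seqCount (k + a) (k + (a + m))
          (fun p => ((pairMatrix (a + 1) (a + m) k p).rank : ℤ) = i - 1)
        - 2 * seqCount (k + a) (k + (a + m))
          (fun p => ((pairMatrix a (a + m) k p).rank : ℤ) = i - 2)
        + (stableCount a (a + m) k i - 3 * stableCount a (a + m) k (i - 1)
          + 2 * stableCount a (a + m) k (i - 2)) := by
  classical
  have h1 := seqCount_window_add a m k (i - 1)
  have h2 := seqCount_window_add a m k (i - 2)
  rw [← sub_eq_zero] at h1 h2
  rw [← add_zero (_ + (_ - 3 * _ + _)), ← h1, ← sub_zero (_ + (_ - _)), ← h2]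
  simp only [stableCount, seqCount_eq_sum, Finset.mul_sum, ← Finset.sum_add_distrib,
    ← Finset.sum_sub_distrib]
  refine Finset.sum_congr rfl fun p _ => ?_
  convert rank_indicator_identity (rowSpace a (a + m) k p) (window k p.1 a)
    (window k p.2 (a + m)) (r := (pairMatrix a (a + m) k p).rank)
    (ru := (pairMatrix (a + 1) (a + m) k p).rank) (rv := (pairMatrix a (a + m + 1) k p).rank)
    (ruv := (pairMatrix (a + 1) (a + m + 1) k p).rank) (rank_pairMatrix ..)
    (by rw [rank_pairMatrix, rowSpace_succ_left]) (by rw [rank_pairMatrix, rowSpace_succ_right])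
    (by rw [rank_pairMatrix, rowSpace_succ_right, rowSpace_succ_left]) i

end Recurrence

/-! ### Persymmetric matrices and classes of Laurent series as finite sequences -/

section Translation

/-- A pair of sequences of lengths `a + k - 1` and `b + k - 1` amounts to a double persymmetric
matrix. -/
theorem Gam_eq_seqCount {a b k : ℕ} (ha : 1 ≤ a) (hb : 1 ≤ b) (hk : 1 ≤ k) (i : ℤ) :
    Gam a b k i = seqCount (k + a - 1) (k + b - 1) fun p => ((pairMatrix a b k p).rank : ℤ) = i := by
  have himg : doublePersymmetricOfRank a b k i = pairMatrix a b k ''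
      {p | p ∈ seqBox (k + a - 1) (k + b - 1) ∧ ((pairMatrix a b k p).rank : ℤ) = i} := by
    have key : ∀ {c : ℕ} (hc : 1 ≤ c) (A : Matrix (Fin c) (Fin k) (ZMod 2)), IsPersymmetric A →
        ∃ α : ℕ → ZMod 2, (∀ n, k + c - 1 ≤ n → α n = 0) ∧
          ∀ (x : Fin c) (y : Fin k), α (x + y) = A x y := by
      intro c hc A hA
      -- the entry on the `n`-th antidiagonal, read off in row `min n (c - 1)`
      refine ⟨fun n => if h : n < k + c - 1 then
        A ⟨min n (c - 1), by omega⟩ ⟨n - min n (c - 1), by omega⟩ else 0, fun n hn => ?_,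
        fun x y => ?_⟩
      · exact dif_neg (by omega)
      · have hx := x.2
        have hy := y.2
        refine (dif_pos (show (x : ℕ) + y < k + c - 1 by omega)).trans ?_
        exact hA _ _ _ _ (by simp only; omega)
    ext M
    constructor
    · rintro ⟨h1, h2, h3⟩
      obtain ⟨α, hα0, hα⟩ := key ha _ h1
      obtain ⟨β, hβ0, hβ⟩ := key hb _ h2
      have hM : pairMatrix a b k (α, β) = M := by
        ext (x | x) y
        · exact hα x y
        · exact hβ x y
      exact ⟨(α, β), ⟨mem_seqBox.2 ⟨hα0, hβ0⟩, by rw [hM, h3]⟩, hM⟩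
    · rintro ⟨p, ⟨-, hp⟩, rfl⟩
      refine ⟨fun x x' y y' h => ?_, fun x x' y y' h => ?_, hp⟩
      · exact congrArg p.1 h
      · exact congrArg p.2 h
  rw [Gam, seqCount_eq_ncard, himg, Set.InjOn.ncard_image]
  rintro p ⟨hp, -⟩ q ⟨hq, -⟩ h
  have hent := fun x y => congrFun (congrFun h x) y
  refine eq_of_mem_seqBox hp hq (fun n hn => ?_) fun n hn => ?_
  · have h1 : p.1 (min n (a - 1) + (n - min n (a - 1))) =
        q.1 (min n (a - 1) + (n - min n (a - 1))) :=
      hent (Sum.inl ⟨min n (a - 1), by omega⟩) ⟨n - min n (a - 1), by omega⟩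
    rwa [show min n (a - 1) + (n - min n (a - 1)) = n by omega] at h1
  · have h1 : p.2 (min n (b - 1) + (n - min n (b - 1))) =
        q.2 (min n (b - 1) + (n - min n (b - 1))) :=
      hent (Sum.inr ⟨min n (b - 1), by omega⟩) ⟨n - min n (b - 1), by omega⟩
    rwa [show min n (b - 1) + (n - min n (b - 1)) = n by omega] at h1

/-- The series `∑_{n ≥ 1} α_{n-1} T⁻ⁿ` in the unit interval. -/
noncomputable def seqSeries (α : ℕ → ZMod 2) : UnitInterval :=
  ⟨((PowerSeries.mk fun n => if n = 0 then 0 else α (n - 1) : PowerSeries (ZMod 2)) : KK), by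
    intro n hn
    rw [PowerSeries.coeff_coe]
    split_ifs with h
    · rfl
    · rw [PowerSeries.coeff_mk, if_pos (by simp at hn; omega)]⟩

theorem coeff_seqSeries (α : ℕ → ZMod 2) (n : ℕ) :
    (seqSeries α : KK).coeff ((n : ℤ) + 1) = α n := by
  rw [seqSeries, show ((n : ℤ) + 1) = ((n + 1 : ℕ) : ℤ) by push_cast; rfl,
    LaurentSeries.coeff_coe_powerSeries, PowerSeries.coeff_mk]
  simp

theorem mk_eq_mk_iff {j : ℕ} {t t' : UnitInterval} :
    (QuotientAddGroup.mk t : PQuot j) = QuotientAddGroup.mk t' ↔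
      ∀ n : ℕ, n < j → (t : KK).coeff ((n : ℤ) + 1) = (t' : KK).coeff ((n : ℤ) + 1) := by
  rw [QuotientAddGroup.eq, AddSubgroup.mem_addSubgroupOf]
  have hcoeff : ∀ n : ℤ, ((-t + t' : UnitInterval) : KK).coeff n =
      -(t : KK).coeff n + (t' : KK).coeff n := fun n => by
    simp
  constructor
  · intro h n hn
    have h1 : ((-t + t' : UnitInterval) : KK).coeff ((n : ℤ) + 1) = 0 := h _ (by omega)
    rw [hcoeff] at h1
    exact neg_add_eq_zero.1 h1
  · intro h n hn
    rw [hcoeff]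
    by_cases hn0 : n ≤ 0
    · rw [t.2 n (by simpa using hn0), t'.2 n (by simpa using hn0), neg_zero, add_zero]
    · have h1 := h (n - 1).toNat (by omega)
      rw [show (((n - 1).toNat : ℤ) + 1) = n by omega] at h1
      exact neg_add_eq_zero.2 h1

theorem DD_seqSeries (a b k : ℕ) (p : (ℕ → ZMod 2) × (ℕ → ZMod 2)) :
    DD a b k (seqSeries p.1) (seqSeries p.2) = pairMatrix a b k p := by
  ext (x | x) y
  · exact coeff_seqSeries p.1 (x + y)
  · exact coeff_seqSeries p.2 (x + y)

theorem sig_eq_stableCount (a m k : ℕ) (i : ℤ) :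
    sig (a + 1) m k i = stableCount a (a + m) k i := by
  rw [sig, stableCount, seqCount_eq_ncard]
  have e2 : a + 1 + m - 1 = a + m := by omega
  have e3 : a + 1 + m = a + m + 1 := by omega
  let φ : (ℕ → ZMod 2) × (ℕ → ZMod 2) → PQuot (k + (a + 1) - 1) × PQuot (k + (a + 1) + m - 1) :=
    fun p => ((QuotientAddGroup.mk (seqSeries p.1) : PQuot (k + (a + 1) - 1)),
      (QuotientAddGroup.mk (seqSeries p.2) : PQuot (k + (a + 1) + m - 1)))
  have himg : sigSet (a + 1) m k i = φ '' {p | p ∈ seqBox (k + a) (k + (a + m)) ∧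
      ((pairMatrix a (a + m) k p).rank : ℤ) = i ∧
      ((pairMatrix (a + 1) (a + m) k p).rank : ℤ) = i ∧
      ((pairMatrix (a + 1) (a + m + 1) k p).rank : ℤ) = i} := by
    ext x
    constructor
    · rintro ⟨t, η, rfl, h1, h2, h3⟩
      let p : (ℕ → ZMod 2) × (ℕ → ZMod 2) :=
        (fun n => if n < k + a then (t : KK).coeff ((n : ℤ) + 1) else 0,
          fun n => if n < k + (a + m) then (η : KK).coeff ((n : ℤ) + 1) else 0)
      have ht : (QuotientAddGroup.mk t : PQuot (k + (a + 1) - 1)) =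
          QuotientAddGroup.mk (seqSeries p.1) :=
        mk_eq_mk_iff.2 fun n hn => by rw [coeff_seqSeries]; exact (if_pos hn).symm
      have hη : (QuotientAddGroup.mk η : PQuot (k + (a + 1) + m - 1)) =
          QuotientAddGroup.mk (seqSeries p.2) :=
        mk_eq_mk_iff.2 fun n hn => by
          rw [coeff_seqSeries]; exact (if_pos (by omega)).symm
      rw [DD_congr (by omega) (by omega) ht hη, DD_seqSeries] at h1 h2 h3
      rw [e2] at h1 h2
      rw [e3] at h3
      refine ⟨p, ⟨mem_seqBox.2 ⟨fun n hn => if_neg (by omega), fun n hn => if_neg (by omega)⟩,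
        h1, h2, h3⟩, ?_⟩
      exact Prod.ext ht.symm hη.symm
    · rintro ⟨p, ⟨-, h1, h2, h3⟩, rfl⟩
      refine ⟨seqSeries p.1, seqSeries p.2, rfl, ?_⟩
      simp only [DD_seqSeries]
      rw [e2, e3]
      exact ⟨h1, h2, h3⟩
  rw [himg, Set.InjOn.ncard_image]
  rintro p ⟨hp, -⟩ q ⟨hq, -⟩ h
  have h1 := mk_eq_mk_iff.1 (congrArg Prod.fst h)
  have h2 := mk_eq_mk_iff.1 (congrArg Prod.snd h)
  simp only [coeff_seqSeries] at h1 h2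
  exact eq_of_mem_seqBox hp hq (fun n hn => h1 n hn) fun n hn => h2 n (by omega)

end Translation

/-! ### Linear relations between the columns -/

section Relations

open Polynomial

variable {F : Type*} [Field F]

/-- The value `∑_q C_q α_{n+q}`; the sequence `α` satisfies at the place `n` the linear recurrence
with coefficients those of `C` if this vanishes. -/
noncomputable def recEval (α : ℕ → F) (n : ℕ) : F[X] →ₗ[F] F :=
  Polynomial.lsum fun q => LinearMap.toSpanSingleton F F (α (n + q))

theorem recEval_eq_sum (α : ℕ → F) (n : ℕ) {C : F[X]} {k : ℕ} (hC : C.natDegree < k) :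
    recEval α n C = ∑ q ∈ Finset.range k, C.coeff q * α (n + q) := by
  rw [recEval, Polynomial.lsum_apply, Polynomial.sum_over_range' C (by simp) k hC]
  simp

theorem recEval_X_mul (α : ℕ → F) (n : ℕ) (C : F[X]) :
    recEval α n (X * C) = recEval α (n + 1) C := by
  induction C using Polynomial.induction_on' with
  | add p q hp hq => rw [mul_add, map_add, map_add, hp, hq]
  | monomial q c =>
    rw [X_mul_monomial, recEval, recEval, Polynomial.lsum_apply, Polynomial.lsum_apply,
      Polynomial.sum_monomial_index _ _ (by simp), Polynomial.sum_monomial_index _ _ (by simp),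
      show n + (q + 1) = n + 1 + q by omega]

theorem recEval_X_pow_mul (α : ℕ → F) (n j : ℕ) (C : F[X]) :
    recEval α n (X ^ j * C) = recEval α (n + j) C := by
  induction j generalizing n with
  | zero => rw [pow_zero, one_mul, add_zero]
  | succ j ih => rw [pow_succ', mul_assoc, recEval_X_mul, ih, show n + 1 + j = n + (j + 1) by omega]

theorem recEval_congr {α α' : ℕ → F} {n N : ℕ} {C : F[X]} (h : ∀ q < N, α q = α' q)
    (hC : n + C.natDegree < N) : recEval α n C = recEval α' n C := by
  rw [recEval_eq_sum α n (Nat.lt_succ_self _), recEval_eq_sum α' n (Nat.lt_succ_self _)]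
  refine Finset.sum_congr rfl fun q hq => ?_
  rw [h (n + q) (by have := Finset.mem_range.1 hq; omega)]

theorem recEval_of_monic (α : ℕ → F) (n : ℕ) {P : F[X]} (hP : P.Monic) :
    recEval α n P = ∑ q ∈ Finset.range P.natDegree, P.coeff q * α (n + q) + α (n + P.natDegree) := by
  rw [recEval_eq_sum α n (Nat.lt_succ_self _), Finset.sum_range_succ, hP.coeff_natDegree, one_mul]

theorem eq_of_recEval_eq_zero {α α' : ℕ → F} {P : F[X]} (hP : P.Monic) {L : ℕ}
    (hα : ∀ n, n + P.natDegree < L → recEval α n P = 0)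
    (hα' : ∀ n, n + P.natDegree < L → recEval α' n P = 0)
    (h : ∀ n < P.natDegree, α n = α' n) : ∀ n < L, α n = α' n := by
  intro n
  induction n using Nat.strong_induction_on with
  | _ n ih =>
    intro hn
    by_cases hnP : n < P.natDegree
    · exact h n hnP
    · obtain ⟨l, rfl⟩ := Nat.exists_eq_add_of_le' (not_lt.1 hnP)
      have h1 := (hα l hn).trans (hα' l hn).symm
      rw [recEval_of_monic α l hP, recEval_of_monic α' l hP] at h1
      have h2 : ∀ q ∈ Finset.range P.natDegree,
          P.coeff q * α (l + q) = P.coeff q * α' (l + q) := fun q hq => by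
        have := Finset.mem_range.1 hq
        rw [ih (l + q) (by omega) (by omega)]
      rw [Finset.sum_congr rfl h2] at h1
      exact add_left_cancel h1

theorem exists_recEval_eq_zero {P : F[X]} (hP : P.Monic) (α₀ : ℕ → F) :
    ∃ α : ℕ → F, (∀ n < P.natDegree, α n = α₀ n) ∧ ∀ n, recEval α n P = 0 := by
  let E : LinearRecurrence F := ⟨P.natDegree, fun q => -P.coeff q⟩
  refine ⟨E.mkSol fun q => α₀ q, fun n hn => E.mkSol_eq_init _ ⟨n, hn⟩, fun n => ?_⟩
  have h : E.mkSol (fun q => α₀ q) (n + P.natDegree) =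
      ∑ q : Fin P.natDegree, -P.coeff q * E.mkSol (fun q => α₀ q) (n + q) :=
    E.is_sol_mkSol _ n
  rw [recEval_of_monic _ n hP, h, ← Fin.sum_univ_eq_sum_range
    (fun q => P.coeff q * E.mkSol (fun q => α₀ q) (n + q)), ← Finset.sum_add_distrib]
  exact Finset.sum_eq_zero fun q _ => by ring

/-- The linear relations between the columns of `pairMatrix a b k p`, the coefficients of a relation
being written as a polynomial of degree less than `k`. Multiplication by `X` shifts a relation to
the next columns, at the cost of one row in each block. -/
noncomputable def relations (a b k : ℕ) (p : (ℕ → F) × (ℕ → F)) : Submodule F F[X] :=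
  degreeLT F k ⊓ ((⨅ n : Fin a, LinearMap.ker (recEval p.1 n)) ⊓
    ⨅ n : Fin b, LinearMap.ker (recEval p.2 n))

theorem mem_relations {a b k : ℕ} {p : (ℕ → F) × (ℕ → F)} {C : F[X]} :
    C ∈ relations a b k p ↔
      C.degree < k ∧ (∀ n < a, recEval p.1 n C = 0) ∧ ∀ n < b, recEval p.2 n C = 0 := by
  simp only [relations, Submodule.mem_inf, mem_degreeLT, Submodule.mem_iInf, LinearMap.mem_ker,
    Fin.forall_iff]

theorem relations_le (a b k : ℕ) (p : (ℕ → F) × (ℕ → F)) : relations a b k p ≤ degreeLT F k :=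
  inf_le_left

instance (k : ℕ) : FiniteDimensional F (degreeLT F k) :=
  LinearEquiv.finiteDimensional (degreeLTEquiv F k).symm

instance (a b k : ℕ) (p : (ℕ → F) × (ℕ → F)) : FiniteDimensional F (relations a b k p) :=
  Submodule.finiteDimensional_of_le (relations_le a b k p)

theorem finrank_degreeLT (k : ℕ) : Module.finrank F (degreeLT F k) = k := by
  rw [(degreeLTEquiv F k).finrank_eq, Module.finrank_fin_fun]

theorem natDegree_lt_of_degree_lt {C : F[X]} {k : ℕ} (h : C.degree < k) (h0 : C ≠ 0) :
    C.natDegree < k :=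
  (natDegree_lt_iff_degree_lt h0).2 h

theorem rank_add_finrank_relations (a b k : ℕ) (p : (ℕ → F) × (ℕ → F)) :
    (pairMatrix a b k p).rank + Module.finrank F (relations a b k p) = k := by
  let g : (Fin k → F) →ₗ[F] F[X] :=
    (degreeLT F k).subtype ∘ₗ (degreeLTEquiv F k).symm.toLinearMap
  have hg : Function.Injective g :=
    Subtype.val_injective.comp (degreeLTEquiv F k).symm.injective
  have hval : ∀ (C : F[X]) (hC : C.degree < k) (α : ℕ → F) (n : ℕ),
      ∑ j : Fin k, α (n + j) * degreeLTEquiv F k ⟨C, mem_degreeLT.2 hC⟩ j = recEval α n C := by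
    intro C hC α n
    rcases eq_or_ne C 0 with rfl | h0
    · rw [map_zero]
      refine Finset.sum_eq_zero fun j _ => ?_
      simp [degreeLTEquiv]
    · rw [recEval_eq_sum α n (natDegree_lt_of_degree_lt hC h0),
        ← Fin.sum_univ_eq_sum_range (fun q => C.coeff q * α (n + q))]
      exact Finset.sum_congr rfl fun j _ => mul_comm _ _
  have hmap : (LinearMap.ker (pairMatrix a b k p).mulVecLin).map g = relations a b k p := by
    have hker : ∀ (C : F[X]) (hC : C.degree < k),
        degreeLTEquiv F k ⟨C, mem_degreeLT.2 hC⟩ ∈ LinearMap.ker (pairMatrix a b k p).mulVecLin ↔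
          (∀ n < a, recEval p.1 n C = 0) ∧ ∀ n < b, recEval p.2 n C = 0 := by
      intro C hC
      rw [LinearMap.mem_ker, Matrix.mulVecLin_apply, funext_iff, Sum.forall, Fin.forall_iff,
        Fin.forall_iff]
      simp only [← hval C hC]
      rfl
    ext C
    rw [mem_relations, Submodule.mem_map]
    constructor
    · rintro ⟨c, hc, rfl⟩
      have hC : (g c).degree < k := mem_degreeLT.1 ((degreeLTEquiv F k).symm c).2
      refine ⟨hC, (hker _ hC).1 ?_⟩
      have : degreeLTEquiv F k ⟨g c, mem_degreeLT.2 hC⟩ = c :=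
        (degreeLTEquiv F k).apply_symm_apply c
      rwa [this]
    · rintro ⟨hC, h⟩
      refine ⟨_, (hker C hC).2 h, ?_⟩
      exact congrArg Subtype.val ((degreeLTEquiv F k).symm_apply_apply ⟨C, mem_degreeLT.2 hC⟩)
  rw [← hmap, ← (Submodule.equivMapOfInjective g hg _).finrank_eq, Matrix.rank,
    LinearMap.finrank_range_add_finrank_ker, Module.finrank_fin_fun]

theorem rank_pairMatrix_mono {a a' b b' k k' : ℕ} (ha : a ≤ a') (hb : b ≤ b') (hk : k ≤ k')
    (p : (ℕ → F) × (ℕ → F)) : (pairMatrix a b k p).rank ≤ (pairMatrix a' b' k' p).rank := by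
  have h : pairMatrix a b k p = (pairMatrix a' b' k' p).submatrix
      (Sum.map (Fin.castLE ha) (Fin.castLE hb)) (Fin.castLE hk) := by
    ext (x | x) y <;> rfl
  rw [h]
  exact Matrix.rank_submatrix_le _ _ _

theorem exists_monic_mem_relations {a b i : ℕ} {p : (ℕ → F) × (ℕ → F)}
    (h : (pairMatrix a b i p).rank = i) (h' : (pairMatrix a b (i + 1) p).rank = i) :
    ∃ P : F[X], P.Monic ∧ P.natDegree = i ∧ P ∈ relations a b (i + 1) p := by
  have h1 := rank_add_finrank_relations a b i p
  have h2 := rank_add_finrank_relations a b (i + 1) p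
  have hbot : relations a b i p = ⊥ := Submodule.finrank_eq_zero.1 (by omega)
  obtain ⟨C, hC, h0⟩ := Submodule.exists_mem_ne_zero_of_ne_bot
    (show relations a b (i + 1) p ≠ ⊥ from fun hb => by
      rw [hb, finrank_bot] at h2; omega)
  have hdeg : C.natDegree = i := by
    have hlt := natDegree_lt_of_degree_lt (mem_relations.1 hC).1 h0
    by_contra hne
    refine h0 ((Submodule.mem_bot F).1 (hbot ▸ mem_relations.2 ⟨?_, (mem_relations.1 hC).2⟩))
    exact (natDegree_lt_iff_degree_lt h0).1 (by omega)
  refine ⟨C.leadingCoeff⁻¹ • C, ?_, ?_, Submodule.smul_mem _ _ hC⟩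
  · rw [smul_eq_C_mul, mul_comm]
    exact monic_mul_leadingCoeff_inv h0
  · rw [smul_eq_C_mul, natDegree_C_mul (inv_ne_zero (leadingCoeff_ne_zero.2 h0)), hdeg]

theorem eq_of_monic_mem_relations {a b i : ℕ} {p : (ℕ → F) × (ℕ → F)}
    (h : (pairMatrix a b i p).rank = i) {P Q : F[X]} (hP : P.Monic) (hQ : Q.Monic)
    (hPi : P.natDegree = i) (hQi : Q.natDegree = i) (hPm : P ∈ relations a b (i + 1) p)
    (hQm : Q ∈ relations a b (i + 1) p) : P = Q := by
  have h1 := rank_add_finrank_relations a b i p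
  have hbot : relations a b i p = ⊥ := Submodule.finrank_eq_zero.1 (by omega)
  have hdeg : (P - Q).degree < i := by
    rw [← hPi, ← degree_eq_natDegree hP.ne_zero]
    refine degree_sub_lt_left ?_ hP.ne_zero (by rw [hP.leadingCoeff, hQ.leadingCoeff])
    rw [degree_eq_natDegree hP.ne_zero, degree_eq_natDegree hQ.ne_zero, hPi, hQi]
  have hmem : P - Q ∈ relations a b i p :=
    mem_relations.2 ⟨hdeg, (mem_relations.1 (Submodule.sub_mem _ hPm hQm)).2⟩
  rw [hbot, Submodule.mem_bot] at hmem
  exact sub_eq_zero.1 hmem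

/-- If `X ^ j * C` is a relation whenever its degree allows, then so are all the multiples of `C`
of degree less than `k`, which form a space of dimension `k - deg C`. -/
theorem sub_natDegree_le_finrank_relations {a b k : ℕ} {p : (ℕ → F) × (ℕ → F)} {C : F[X]}
    (h0 : C ≠ 0) (h : ∀ j, j + C.natDegree < k → X ^ j * C ∈ relations a b k p) :
    k - C.natDegree ≤ Module.finrank F (relations a b k p) := by
  classical
  have hinj : Function.Injective (LinearMap.mulRight F C) := fun D D' hD =>
    mul_right_cancel₀ h0 hD
  have hle : (degreeLT F (k - C.natDegree)).map (LinearMap.mulRight F C) ≤ relations a b k p := by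
    rw [degreeLT_eq_span_X_pow, Submodule.map_span_le]
    intro D hD
    simp only [Finset.coe_image, Set.mem_image, Finset.coe_range, Set.mem_Iio] at hD
    obtain ⟨j, hj, rfl⟩ := hD
    exact h j (by omega)
  calc k - C.natDegree = Module.finrank F (degreeLT F (k - C.natDegree)) :=
        (finrank_degreeLT _).symm
    _ = Module.finrank F ((degreeLT F (k - C.natDegree)).map (LinearMap.mulRight F C)) :=
        (Submodule.equivMapOfInjective _ hinj _).finrank_eq
    _ ≤ _ := Submodule.finrank_mono hle

/-- If a further row in each block does not change the rank, then it does not change the relations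
either, which are therefore closed under multiplication by `X` as far as the degree allows. -/
theorem X_pow_mul_mem_relations {a b k : ℕ} {p : (ℕ → F) × (ℕ → F)}
    (h : (pairMatrix (a + 1) (b + 1) k p).rank = (pairMatrix a b k p).rank) {C : F[X]} (h0 : C ≠ 0)
    (hC : C ∈ relations a b k p) (j : ℕ) (hj : j + C.natDegree < k) :
    X ^ j * C ∈ relations (a + 1) (b + 1) k p := by
  have hle : relations (a + 1) (b + 1) k p ≤ relations a b k p := by
    intro D hD
    rw [mem_relations] at hD ⊢
    exact ⟨hD.1, fun n hn => hD.2.1 n (by omega), fun n hn => hD.2.2 n (by omega)⟩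
  have h1 := rank_add_finrank_relations a b k p
  have h2 := rank_add_finrank_relations (a + 1) (b + 1) k p
  have heq := Submodule.eq_of_le_of_finrank_eq hle (by omega)
  induction j with
  | zero => rwa [pow_zero, one_mul, heq]
  | succ j ih =>
    have h3 := mem_relations.1 (ih (by omega))
    rw [heq, pow_succ', mul_assoc, mem_relations]
    refine ⟨?_, fun n hn => ?_, fun n hn => ?_⟩
    · rw [← mul_assoc, ← pow_succ', degree_mul, degree_X_pow, degree_eq_natDegree h0]
      exact_mod_cast hj
    · rw [recEval_X_mul]; exact h3.2.1 _ (by omega)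
    · rw [recEval_X_mul]; exact h3.2.2 _ (by omega)

/-- If a further row in each block leaves the rank `i` unchanged, then the first `i` columns are
independent and span all the columns. -/
theorem rank_initial_columns {a b i k : ℕ} {p : (ℕ → F) × (ℕ → F)} (hik : i < k)
    (h : (pairMatrix a b k p).rank = i) (h' : (pairMatrix (a + 1) (b + 1) k p).rank = i) :
    (pairMatrix a b i p).rank = i ∧ (pairMatrix a b (i + 1) p).rank = i := by
  have hi : (pairMatrix a b i p).rank = i := by
    have h1 := rank_add_finrank_relations a b i p
    have h2 := rank_add_finrank_relations (a + 1) (b + 1) k p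
    suffices hbot : relations a b i p = ⊥ by
      rw [hbot, finrank_bot] at h1; exact h1
    rw [Submodule.eq_bot_iff]
    intro C hC
    by_contra h0
    -- a relation of degree `d < i` has too many multiples: they fill dimension `k - d > k - i`
    have hdeg := natDegree_lt_of_degree_lt (mem_relations.1 hC).1 h0
    have hCk : C ∈ relations a b k p := mem_relations.2
      ⟨(natDegree_lt_iff_degree_lt h0).1 (by omega), (mem_relations.1 hC).2⟩
    have h3 := sub_natDegree_le_finrank_relations h0
      (X_pow_mul_mem_relations (h'.trans h.symm) h0 hCk)
    omega
  refine ⟨hi, le_antisymm ?_ ?_⟩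
  · exact (rank_pairMatrix_mono le_rfl le_rfl hik p).trans h.le
  · exact hi.ge.trans (rank_pairMatrix_mono le_rfl le_rfl (Nat.le_succ i) p)

/-- Under the hypotheses of `rank_initial_columns`, the relation of degree `i` is a linear recurrence
satisfied by the whole of both sequences, of lengths `k + a` and `k + b`. -/
theorem exists_recurrence_of_stable {a b i k : ℕ} {p : (ℕ → F) × (ℕ → F)} (hik : i < k)
    (h : (pairMatrix a b k p).rank = i) (h' : (pairMatrix (a + 1) (b + 1) k p).rank = i) :
    ∃ P : F[X], P.Monic ∧ P.natDegree = i ∧ P ∈ relations a b (i + 1) p ∧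
      (∀ n, n + P.natDegree < k + a → recEval p.1 n P = 0) ∧
      ∀ n, n + P.natDegree < k + b → recEval p.2 n P = 0 := by
  obtain ⟨hi, hi'⟩ := rank_initial_columns hik h h'
  obtain ⟨P, hP, hPi, hmem⟩ := exists_monic_mem_relations hi hi'
  have hmemk : P ∈ relations a b k p := mem_relations.2
    ⟨(natDegree_lt_iff_degree_lt hP.ne_zero).1 (by omega), (mem_relations.1 hmem).2⟩
  have hX := fun j hj => mem_relations.1
    (X_pow_mul_mem_relations (h'.trans h.symm) hP.ne_zero hmemk j hj)
  refine ⟨P, hP, hPi, hmem, fun n hn => ?_, fun n hn => ?_⟩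
  · have := (hX (n - a) (by omega)).2.1 (n - (n - a)) (by omega)
    rwa [recEval_X_pow_mul, Nat.sub_add_cancel (Nat.sub_le n a)] at this
  · have := (hX (n - b) (by omega)).2.2 (n - (n - b)) (by omega)
    rwa [recEval_X_pow_mul, Nat.sub_add_cancel (Nat.sub_le n b)] at this

theorem rank_le_natDegree_of_recurrence {a b k : ℕ} {p : (ℕ → F) × (ℕ → F)} {P : F[X]}
    (hP : P.Monic) (hPk : P.natDegree ≤ k)
    (h₁ : ∀ n, n + P.natDegree < k + a → recEval p.1 n P = 0)
    (h₂ : ∀ n, n + P.natDegree < k + b → recEval p.2 n P = 0) :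
    (pairMatrix (a + 1) (b + 1) k p).rank ≤ P.natDegree := by
  have h3 := rank_add_finrank_relations (a + 1) (b + 1) k p
  have h4 := sub_natDegree_le_finrank_relations (a := a + 1) (b := b + 1) (k := k) (p := p)
    hP.ne_zero fun j hj => mem_relations.2 ⟨by
        rw [degree_mul, degree_X_pow, degree_eq_natDegree hP.ne_zero]; exact_mod_cast hj,
      fun n hn => by rw [recEval_X_pow_mul]; exact h₁ _ (by omega),
      fun n hn => by rw [recEval_X_pow_mul]; exact h₂ _ (by omega)⟩
  omega

end Relations

/-! ### The number of stable pairs -/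

section StableCount

/-- The first `L` terms of `p.1` and the first `L'` terms of `p.2`. -/
def truncPair (L L' : ℕ) (p : (ℕ → ZMod 2) × (ℕ → ZMod 2)) : (ℕ → ZMod 2) × (ℕ → ZMod 2) :=
  (fun n => if n < L then p.1 n else 0, fun n => if n < L' then p.2 n else 0)

theorem truncPair_fst {L L' n : ℕ} (p : (ℕ → ZMod 2) × (ℕ → ZMod 2)) (hn : n < L) :
    (truncPair L L' p).1 n = p.1 n := if_pos hn

theorem truncPair_snd {L L' n : ℕ} (p : (ℕ → ZMod 2) × (ℕ → ZMod 2)) (hn : n < L') :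
    (truncPair L L' p).2 n = p.2 n := if_pos hn

theorem truncPair_mem_seqBox (L L' : ℕ) (p : (ℕ → ZMod 2) × (ℕ → ZMod 2)) :
    truncPair L L' p ∈ seqBox L L' :=
  mem_seqBox.2 ⟨fun _ hn => if_neg hn.not_gt, fun _ hn => if_neg hn.not_gt⟩

theorem pairMatrix_truncPair {a b k L L' : ℕ} (h₁ : a + k ≤ L + 1) (h₂ : b + k ≤ L' + 1)
    (p : (ℕ → ZMod 2) × (ℕ → ZMod 2)) : pairMatrix a b k (truncPair L L' p) = pairMatrix a b k p :=
  pairMatrix_congr (fun _ hn => truncPair_fst p (by omega)) fun _ hn => truncPair_snd p (by omega)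

/-- A stable pair is determined by its first `i + a` and `i + b` terms, which fill `i + 1` columns:
the dependence of the last of these columns on the others, which are independent, is a recurrence
of order `i` that continues both sequences. -/
theorem stableCount_eq_seqCount_initial (a b : ℕ) {k i : ℕ} (hik : i < k) :
    stableCount a b k i = seqCount (i + a) (i + b) fun p =>
      (pairMatrix a b i p).rank = i ∧ (pairMatrix a b (i + 1) p).rank = i := by
  refine seqCount_eq_of_bijOn (truncPair (i + a) (i + b)) ⟨?_, ?_, ?_⟩
  · rintro p ⟨-, h1, -, h3⟩
    refine ⟨truncPair_mem_seqBox _ _ p, ?_⟩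
    rw [pairMatrix_truncPair (by omega) (by omega), pairMatrix_truncPair (by omega) (by omega)]
    exact rank_initial_columns hik (by exact_mod_cast h1) (by exact_mod_cast h3)
  · rintro p ⟨hp, h1, -, h3⟩ q ⟨hq, h1', -, h3'⟩ h
    have e1 : ∀ n < i + a, p.1 n = q.1 n := fun n hn => by
      rw [← truncPair_fst (L' := i + b) p hn, h, truncPair_fst q hn]
    have e2 : ∀ n < i + b, p.2 n = q.2 n := fun n hn => by
      rw [← truncPair_snd (L := i + a) p hn, h, truncPair_snd q hn]
    obtain ⟨P, hP, hPi, hPm, hP1, hP2⟩ := exists_recurrence_of_stable hik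
      (by exact_mod_cast h1) (by exact_mod_cast h3)
    obtain ⟨Q, hQ, hQi, hQm, hQ1, hQ2⟩ := exists_recurrence_of_stable hik
      (by exact_mod_cast h1') (by exact_mod_cast h3')
    have hQm' : Q ∈ relations a b (i + 1) p := by
      rw [mem_relations] at hQm ⊢
      refine ⟨hQm.1, fun n hn => ?_, fun n hn => ?_⟩
      · rw [recEval_congr e1 (by omega)]; exact hQm.2.1 n hn
      · rw [recEval_congr e2 (by omega)]; exact hQm.2.2 n hn
    obtain rfl : P = Q := eq_of_monic_mem_relations
      (rank_initial_columns hik (by exact_mod_cast h1) (by exact_mod_cast h3)).1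
      hP hQ hPi hQi hPm hQm'
    exact eq_of_mem_seqBox hp hq
      (eq_of_recEval_eq_zero hP hP1 hQ1 fun n hn => e1 n (by omega))
      (eq_of_recEval_eq_zero hP hP2 hQ2 fun n hn => e2 n (by omega))
  · rintro q ⟨hq, hi, hi'⟩
    obtain ⟨P, hP, hPi, hPm⟩ := exists_monic_mem_relations hi hi'
    rw [mem_relations] at hPm
    obtain ⟨α, hα, hαP⟩ := exists_recEval_eq_zero hP q.1
    obtain ⟨β, hβ, hβP⟩ := exists_recEval_eq_zero hP q.2
    have e1 : ∀ n < i + a, α n = q.1 n :=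
      eq_of_recEval_eq_zero hP (fun n _ => hαP n) (fun n hn => hPm.2.1 n (by omega)) hα
    have e2 : ∀ n < i + b, β n = q.2 n :=
      eq_of_recEval_eq_zero hP (fun n _ => hβP n) (fun n hn => hPm.2.2 n (by omega)) hβ
    have hrank : (pairMatrix a b i (α, β)).rank = i := by
      rw [pairMatrix_congr (q := q) (fun n hn => e1 n (by omega)) fun n hn => e2 n (by omega), hi]
    have hle := rank_le_natDegree_of_recurrence (a := a) (b := b) (k := k) (p := (α, β)) hP
      (by omega) (fun n _ => hαP n) (fun n _ => hβP n)
    have h1 := rank_pairMatrix_mono (le_refl a) (le_refl b) hik.le (α, β)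
    have h2 := rank_pairMatrix_mono (Nat.le_succ a) (le_refl b) (le_refl k) (α, β)
    have h3 := rank_pairMatrix_mono (le_refl (a + 1)) (Nat.le_succ b) (le_refl k) (α, β)
    simp only [Nat.succ_eq_add_one] at h2 h3
    refine ⟨truncPair (k + a) (k + b) (α, β), ⟨truncPair_mem_seqBox _ _ _, ?_⟩, ?_⟩
    · rw [pairMatrix_truncPair (by omega) (by omega), pairMatrix_truncPair (by omega) (by omega),
        pairMatrix_truncPair (by omega) (by omega)]
      omega
    · refine eq_of_mem_seqBox (truncPair_mem_seqBox _ _ _) hq (fun n hn => ?_) fun n hn => ?_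
      · rw [truncPair_fst _ hn, truncPair_fst _ (by omega)]; exact e1 n hn
      · rw [truncPair_snd _ hn, truncPair_snd _ (by omega)]; exact e2 n hn

theorem seqCount_eq_add (L L' : ℕ) (Q R : (ℕ → ZMod 2) × (ℕ → ZMod 2) → Prop) :
    seqCount L L' Q = seqCount L L' (fun p => Q p ∧ R p) + seqCount L L' (fun p => Q p ∧ ¬R p) := by
  classical
  rw [seqCount, seqCount, seqCount,
    ← Finset.card_filter_add_card_filter_not (s := (seqBox L L').filter Q) R,
    Finset.filter_filter, Finset.filter_filter]
  push_cast
  congr!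

/-- The two free last terms quadruple the number of matrices. -/
theorem four_mul_Gam {a b k : ℕ} (ha : 1 ≤ a) (hb : 1 ≤ b) (hk : 1 ≤ k) (i : ℤ) :
    4 * Gam a b k i =
      seqCount (k + a) (k + b) fun p => ((pairMatrix a b k p).rank : ℤ) = i := by
  rw [Gam_eq_seqCount ha hb hk, seqCount_succ_left_rank _ hk, seqCount_succ_right_rank _ hk]
  ring

theorem rank_pairMatrix_le (a b k : ℕ) (p : (ℕ → ZMod 2) × (ℕ → ZMod 2)) :
    (pairMatrix a b k p).rank ≤ k ∧ (pairMatrix a b k p).rank ≤ a + b :=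
  ⟨by simpa using Matrix.rank_le_card_width (pairMatrix a b k p),
    by simpa using Matrix.rank_le_card_height (pairMatrix a b k p)⟩

theorem stableCount_of_lt {a b k i : ℕ} (ha : 1 ≤ a) (hb : 1 ≤ b) (hi : 1 ≤ i) (hik : i < k) :
    stableCount a b k i = 4 * Gam a b i i - Gam a b (i + 1) (i + 1) := by
  rw [stableCount_eq_seqCount_initial a b hik, four_mul_Gam ha hb hi,
    Gam_eq_seqCount ha hb (Nat.le_add_left 1 i), show i + 1 + a - 1 = i + a by omega,
    show i + 1 + b - 1 = i + b by omega,
    seqCount_eq_add _ _ (fun p => ((pairMatrix a b i p).rank : ℤ) = i)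
      fun p => (pairMatrix a b (i + 1) p).rank = i, eq_sub_iff_add_eq]
  congr 1
  · exact seqCount_congr fun p _ => by norm_cast
  · refine seqCount_congr fun p _ => ?_
    have h1 := rank_pairMatrix_mono (le_refl a) (le_refl b) (Nat.le_succ i) p
    have h2 := (rank_pairMatrix_le a b (i + 1) p).1
    have h3 := (rank_pairMatrix_le a b i p).1
    -- deleting the last column lowers the rank by at most one
    have h4 : (pairMatrix a b (i + 1) p).rank = i + 1 → (pairMatrix a b i p).rank = i := by
      intro h
      have h5 := rank_add_finrank_relations a b (i + 1) p
      have h6 := rank_add_finrank_relations a b i p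
      have h7 : relations a b i p ≤ relations a b (i + 1) p := fun C hC => by
        rw [mem_relations] at hC ⊢
        exact ⟨hC.1.trans (by exact_mod_cast Nat.lt_succ_self i), hC.2⟩
      have h8 := Submodule.finrank_mono h7
      omega
    simp only [Nat.succ_eq_add_one] at h1
    omega

theorem stableCount_self {a b k : ℕ} (ha : 1 ≤ a) (hb : 1 ≤ b) (hk : 1 ≤ k) :
    stableCount a b k k = 4 * Gam a b k k := by
  rw [four_mul_Gam ha hb hk, stableCount]
  refine seqCount_congr fun p _ => ?_
  have h2 := rank_pairMatrix_mono (Nat.le_succ a) (le_refl b) (le_refl k) p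
  have h3 := rank_pairMatrix_mono (le_refl (a + 1)) (Nat.le_succ b) (le_refl k) p
  have h4 := (rank_pairMatrix_le (a + 1) (b + 1) k p).1
  simp only [Nat.succ_eq_add_one] at h2 h3
  omega

theorem stableCount_zero {a b k : ℕ} (hk : 1 ≤ k) : stableCount a b k 0 = 1 := by
  rw [stableCount, seqCount_eq_ncard, show (1 : ℤ) = ((1 : ℕ) : ℤ) from rfl, Nat.cast_inj,
    Set.ncard_eq_one]
  refine ⟨0, Set.eq_singleton_iff_unique_mem.2 ⟨⟨mem_seqBox.2 ⟨fun _ _ => rfl, fun _ _ => rfl⟩, ?_⟩,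
    ?_⟩⟩
  · have h0 : ∀ a b : ℕ, pairMatrix a b k (0 : (ℕ → ZMod 2) × (ℕ → ZMod 2)) = 0 := fun a b => by
      ext (x | x) y <;> rfl
    simp [h0]
  · rintro p ⟨hp, -, -, h⟩
    have hbot : rowSpace (a + 1) (b + 1) k p = ⊥ :=
      Submodule.finrank_eq_zero.1 (by rw [← rank_pairMatrix]; exact_mod_cast h)
    have h1 : ∀ n < a + 1, window k p.1 n = 0 := fun n hn => (Submodule.mem_bot (ZMod 2)).1
      (hbot ▸ Submodule.subset_span (Or.inl ⟨n, hn, rfl⟩))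
    have h2 : ∀ n < b + 1, window k p.2 n = 0 := fun n hn => (Submodule.mem_bot (ZMod 2)).1
      (hbot ▸ Submodule.subset_span (Or.inr ⟨n, hn, rfl⟩))
    refine eq_of_mem_seqBox hp (mem_seqBox.2 ⟨fun _ _ => rfl, fun _ _ => rfl⟩) (fun n hn => ?_)
      fun n hn => ?_
    · have := congrFun (h1 (min n a) (by omega)) ⟨n - min n a, by omega⟩
      simpa [window, Nat.add_sub_cancel' (Nat.min_le_left n a)] using this
    · have := congrFun (h2 (min n b) (by omega)) ⟨n - min n b, by omega⟩
      simpa [window, Nat.add_sub_cancel' (Nat.min_le_left n b)] using this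

theorem seqCount_eq_zero {L L' : ℕ} {Q : (ℕ → ZMod 2) × (ℕ → ZMod 2) → Prop} (h : ∀ p, ¬Q p) :
    seqCount L L' Q = 0 := by
  classical
  simp [seqCount, h]

theorem stableCount_eq_zero {a b k : ℕ} {i : ℤ} (h : i < 0 ∨ (k : ℤ) < i ∨ (a : ℤ) + b < i) :
    stableCount a b k i = 0 := by
  refine seqCount_eq_zero fun p hp => ?_
  have h1 := rank_pairMatrix_le a b k p
  omega

theorem Gam_self_eq_zero {a b j : ℕ} (ha : 1 ≤ a) (hb : 1 ≤ b) (h : a + b < j) :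
    Gam a b j j = 0 := by
  rw [Gam_eq_seqCount ha hb (by omega)]
  refine seqCount_eq_zero fun p hp => ?_
  have h1 := rank_pairMatrix_le a b j p
  omega

theorem Gam_zero_columns (a b : ℕ) : Gam a b 0 0 = 1 := by
  rw [Gam, show (1 : ℤ) = ((1 : ℕ) : ℤ) from rfl, Nat.cast_inj, Set.ncard_eq_one]
  refine ⟨0, Set.eq_singleton_iff_unique_mem.2 ⟨⟨fun _ _ j => j.elim0, fun _ _ j => j.elim0, ?_⟩,
    fun M _ => Subsingleton.elim _ _⟩⟩
  simp

theorem Gam_one_one_one : Gam 1 1 1 1 = 3 := by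
  have h0 := stableCount_eq_seqCount_initial 1 1 (k := 1) (i := 0) one_pos
  rw [Nat.cast_zero, stableCount_zero le_rfl] at h0
  have h1 := seqCount_eq_add 1 1 (fun _ => True) fun p => ((pairMatrix 1 1 1 p).rank : ℤ) = 1
  have h2 : seqCount 1 1 (fun _ => True) = 4 := by
    rw [seqCount_succ_left (L := 0) (fun _ _ _ _ h => h),
      seqCount_succ_right (L' := 0) (fun _ _ _ _ h => h), seqCount_eq_ncard]
    have hz : {p | p ∈ seqBox 0 0 ∧ True} = {0} :=
      Set.eq_singleton_iff_unique_mem.2 ⟨⟨mem_seqBox.2 ⟨fun _ _ => rfl, fun _ _ => rfl⟩, trivial⟩,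
        fun p hp => Prod.ext (funext fun n => (mem_seqBox.1 hp.1).1 n n.zero_le)
          (funext fun n => (mem_seqBox.1 hp.1).2 n n.zero_le)⟩
    rw [hz, Set.ncard_singleton]
    rfl
  have h3 : seqCount 1 1 (fun p => True ∧ ¬((pairMatrix 1 1 1 p).rank : ℤ) = 1) = 1 := by
    refine Eq.trans (seqCount_congr fun p _ => ?_) h0.symm
    have h4 := (rank_pairMatrix_le 1 1 0 p).1
    have h5 := (rank_pairMatrix_le 1 1 1 p).1
    change (True ∧ ¬((pairMatrix 1 1 1 p).rank : ℤ) = 1) ↔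
      (pairMatrix 1 1 0 p).rank = 0 ∧ (pairMatrix 1 1 1 p).rank = 0
    simp only [true_and]
    omega
  rw [h2, h3] at h1
  simp only [true_and] at h1
  rw [Gam_eq_seqCount le_rfl le_rfl le_rfl]
  exact (by linarith : seqCount 1 1 (fun p => ((pairMatrix 1 1 1 p).rank : ℤ) = 1) = 3)

end StableCount

/-! ### The recurrence and the remainder for double persymmetric matrices -/

theorem Gam_recurrence {a : ℕ} (ha : 1 ≤ a) (m : ℕ) {k : ℕ} (hk : 1 ≤ k) (i : ℤ) :
    Gam (a + 1) (a + m + 1) k i =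
      2 * Gam a (a + m + 1) k (i - 1) + 4 * Gam (a + 1) (a + m) k (i - 1)
        - 8 * Gam a (a + m) k (i - 2) + Del (a + 1) m k i := by
  have h := seqCount_rank_recurrence a m k i
  rw [Gam_eq_seqCount (by omega) (by omega) hk, Gam_eq_seqCount ha (by omega) hk,
    Gam_eq_seqCount (by omega) (by omega) hk]
  have h8 := four_mul_Gam ha (show 1 ≤ a + m by omega) hk (i - 2)
  have h2 := seqCount_succ_left_rank (a := a) (b := a + m + 1) (k + (a + m)) hk (i - 1)
  have h4 := seqCount_succ_right_rank (a := a + 1) (b := a + m) (k + a) hk (i - 1)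
  simp only [Del, sig_eq_stableCount]
  simp only [show k + (a + 1) - 1 = k + a by omega, show k + (a + m + 1) - 1 = k + (a + m) by omega]
  linarith

theorem theorem2p2 (s m k : ℕ) (hs : 2 ≤ s) (hk : 1 ≤ k) :
    -- the recurrence, with remainder `Δ_i = σ_{i,i,i} - 3 σ_{i-1,i-1,i-1} + 2 σ_{i-2,i-2,i-2}`
    (∀ i : ℕ, i ≤ min (2 * s + m) k →
      Gam s (s + m) k i
        = 2 * Gam (s - 1) (s + m) k ((i : ℤ) - 1) + 4 * Gam s (s + m - 1) k ((i : ℤ) - 1)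
          - 8 * Gam (s - 1) (s + m - 1) k ((i : ℤ) - 2) + Del s m k i) ∧
    -- the value of `σ_{i,i,i}` in the case `k ≤ 2s+m-2`
    (k ≤ 2 * s + m - 2 →
      sig s m k 0 = 1 ∧
      (∀ i : ℕ, 1 ≤ i → i ≤ k - 1 →
        sig s m k i
          = 4 * Gam (s - 1) (s + m - 1) i i - Gam (s - 1) (s + m - 1) (i + 1) (i + 1)) ∧
      sig s m k k = 4 * Gam (s - 1) (s + m - 1) k k) ∧
    -- the value of `σ_{i,i,i}` in the case `k ≥ 2s+m-2`
    (2 * s + m - 2 ≤ k →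
      sig s m k 0 = 1 ∧
      (∀ i : ℕ, 1 ≤ i → i ≤ 2 * s + m - 3 →
        sig s m k i
          = 4 * Gam (s - 1) (s + m - 1) i i - Gam (s - 1) (s + m - 1) (i + 1) (i + 1)) ∧
      sig s m k ((2 * s + m - 2 : ℕ) : ℤ)
        = 4 * Gam (s - 1) (s + m - 1) (2 * s + m - 2) ((2 * s + m - 2 : ℕ) : ℤ)) ∧
    -- the value of the remainder
    (Del s m k 0 = 1 ∧
      (2 ≤ k → Del s m k 1 = 4 * GamSq s m 1 - GamSq s m 2 - 3) ∧
      (k = 1 → Del s m k 1 = 4 * GamSq s m 1 - 3) ∧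
      (3 ≤ k → Del s m k 2 = 7 * GamSq s m 2 - 12 * GamSq s m 1 - GamSq s m 3 + 2) ∧
      (k = 2 → Del s m k 2 = 7 * GamSq s m 2 - 12 * GamSq s m 1 + 2) ∧
      (∀ i : ℕ, 3 ≤ i → i ≤ 2 * s + m - 3 → i + 1 ≤ k →
        Del s m k i = 7 * GamSq s m i - 14 * GamSq s m (i - 1) + 8 * GamSq s m (i - 2) - GamSq s m (i + 1)) ∧
      (∀ i : ℕ, 3 ≤ i → i ≤ 2 * s + m - 3 → k = i →
        Del s m k i = 7 * GamSq s m i - 14 * GamSq s m (i - 1) + 8 * GamSq s m (i - 2)) ∧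
      (∀ i : ℕ, i = 2 * s + m - 2 → i ≤ k →
        Del s m k i
          = 7 * GamSq s m (2 * s + m - 2) - 14 * GamSq s m (2 * s + m - 3) + 8 * GamSq s m (2 * s + m - 4)) ∧
      (∀ i : ℕ, i = 2 * s + m - 1 → i ≤ k →
        Del s m k i = -14 * GamSq s m (2 * s + m - 2) + 8 * GamSq s m (2 * s + m - 3)) ∧
      (∀ i : ℕ, i = 2 * s + m → i ≤ k →
        Del s m k i = 8 * GamSq s m (2 * s + m - 2))) := by
  obtain ⟨a, rfl⟩ := Nat.exists_eq_add_of_le' (show 1 ≤ s by omega)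
  have ha : 1 ≤ a := by omega
  have hb : 1 ≤ a + m := by omega
  have e1 : a + 1 - 1 = a := rfl
  have e2 : a + 1 + m - 1 = a + m := by omega
  have e3 : a + 1 + m = a + m + 1 := by omega
  -- the values of `σ_{i,i,i}` for `0 < i < k`, for `i = k`, for `i = 0`, and outside the possible ranks
  have hlt : ∀ i : ℕ, 1 ≤ i → i < k →
      sig (a + 1) m k i = 4 * Gam a (a + m) i i - Gam a (a + m) (i + 1) (i + 1) :=
    fun i hi hik => by rw [sig_eq_stableCount, stableCount_of_lt ha hb hi hik]
  have hself : sig (a + 1) m k k = 4 * Gam a (a + m) k k := by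
    rw [sig_eq_stableCount, stableCount_self ha hb hk]
  have hzero : sig (a + 1) m k 0 = 1 := by rw [sig_eq_stableCount, stableCount_zero hk]
  have hout : ∀ i : ℤ, i < 0 ∨ (k : ℤ) < i ∨ (a : ℤ) + (a + m : ℕ) < i → sig (a + 1) m k i = 0 :=
    fun i hi => by rw [sig_eq_stableCount, stableCount_eq_zero hi]
  have hG : ∀ j : ℕ, a + (a + m) < j → Gam a (a + m) j j = 0 :=
    fun j hj => Gam_self_eq_zero ha hb hj
  -- in the topmost possible rank the subtracted term `g_{i+1}` vanishes
  have htop : ∀ i : ℕ, i = a + (a + m) → i ≤ k → sig (a + 1) m k i = 4 * Gam a (a + m) i i := by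
    intro i hi hik
    rcases hik.eq_or_lt with rfl | hlt'
    · exact hself
    · have h0 := hG (i + 1) (by omega)
      push_cast at h0
      rw [hlt i (by omega) hlt', h0, sub_zero]
  have hdel : ∀ i : ℕ, Del (a + 1) m k (i + 2 : ℕ) = sig (a + 1) m k (i + 2 : ℕ)
      - 3 * sig (a + 1) m k (i + 1 : ℕ) + 2 * sig (a + 1) m k i := fun i => by
    rw [Del, show ((i + 2 : ℕ) : ℤ) - 1 = (i + 1 : ℕ) by push_cast; ring,
      show ((i + 2 : ℕ) : ℤ) - 2 = i by push_cast; ring]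
  have hdel1 : Del (a + 1) m k 1 = sig (a + 1) m k 1 - 3 := by
    rw [Del, sub_self, hzero, hout (1 - 2) (Or.inl (by norm_num))]
    ring
  have hsq : ∀ j : ℕ, GamSq (a + 1) m j = Gam a (a + m) j j := fun j => by
    rw [GamSq, e1, e2]
  simp only [hsq, e1, e3]
  refine ⟨fun i _ => Gam_recurrence ha m hk i, fun hk' => ⟨hzero, fun i hi hik => ?_, hself⟩,
    fun hk' => ⟨hzero, fun i hi hik => ?_, ?_⟩, ?_, fun hk2 => ?_, fun hk1 => ?_, fun hk3 => ?_,
    fun hk2 => ?_, fun i hi hi' hik => ?_, fun i hi hi' hik => ?_, fun i hi hik => ?_,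
    fun i hi hik => ?_, fun i hi hik => ?_⟩
  · exact hlt i hi (by omega)
  · exact hlt i hi (by omega)
  · exact htop _ (by omega) hk'
  · rw [Del, hzero, hout (0 - 1) (Or.inl (by norm_num)), hout (0 - 2) (Or.inl (by norm_num))]
    rfl
  · have h1 := hlt 1 le_rfl (by omega)
    push_cast at h1
    rw [hdel1, h1]
    rfl
  · subst hk1
    have h1 := hself
    push_cast at h1
    rw [hdel1, h1]
    rfl
  · have h0 := hdel 0
    have h1 := hlt 1 le_rfl (by omega)
    have h2 := hlt 2 (by omega) (by omega)
    norm_num [hzero] at h0 h1 h2 ⊢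
    linarith
  · subst hk2
    have h0 := hdel 0
    have h1 := hlt 1 le_rfl (by omega)
    have h2 := hself
    norm_num [hzero] at h0 h1 h2 ⊢
    linarith
  · obtain ⟨j, rfl⟩ := Nat.exists_eq_add_of_le' hi
    have h0 := hdel (j + 1)
    have h1 := hlt (j + 1) (by omega) (by omega)
    have h2 := hlt (j + 2) (by omega) (by omega)
    have h3 := hlt (j + 3) (by omega) (by omega)
    rw [show j + 3 - 1 = j + 2 by omega, show j + 3 - 2 = j + 1 by omega]
    push_cast at h0 h1 h2 h3 ⊢
    ring_nf at h0 h1 h2 h3 ⊢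
    linarith
  · obtain ⟨j, rfl⟩ := Nat.exists_eq_add_of_le' hi
    have h0 := hdel (j + 1)
    have h1 := hlt (j + 1) (by omega) (by omega)
    have h2 := hlt (j + 2) (by omega) (by omega)
    have h3 := hself
    subst hik
    rw [show j + 3 - 1 = j + 2 by omega, show j + 3 - 2 = j + 1 by omega]
    push_cast at h0 h1 h2 h3 ⊢
    ring_nf at h0 h1 h2 h3 ⊢
    linarith
  · obtain ⟨j, rfl⟩ := Nat.exists_eq_add_of_le' (show 2 ≤ i by omega)
    have h0 := hdel j
    have h2 := hlt (j + 1) (by omega) (by omega)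
    have h3 := htop (j + 2) (by omega) hik
    rw [show 2 * (a + 1) + m - 2 = j + 2 by omega, show 2 * (a + 1) + m - 3 = j + 1 by omega,
      show 2 * (a + 1) + m - 4 = j by omega]
    rcases j.eq_zero_or_pos with rfl | hj
    · -- here `a = 1` and `m = 0`, and `σ_0 = 1` takes the place of `4 g_0 - g_1 = 4 - 3`
      obtain rfl : a = 1 := by omega
      obtain rfl : m = 0 := by omega
      have hg0 := Gam_zero_columns 1 1
      have hg1 := Gam_one_one_one
      norm_num [hzero] at h0 h2 h3 ⊢
      linarith
    · have h1 := hlt j hj (by omega)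
      push_cast at h0 h1 h2 h3 ⊢
      ring_nf at h0 h1 h2 h3 ⊢
      linarith
  · obtain ⟨j, rfl⟩ := Nat.exists_eq_add_of_le' (show 3 ≤ i by omega)
    have h0 := hdel (j + 1)
    have h1 := hlt (j + 1) (by omega) (by omega)
    have h2 := htop (j + 2) (by omega) (by omega)
    have h3 := hout (j + 3 : ℕ) (by omega)
    rw [show 2 * (a + 1) + m - 2 = j + 2 by omega, show 2 * (a + 1) + m - 3 = j + 1 by omega]
    push_cast at h0 h1 h2 h3 ⊢
    ring_nf at h0 h1 h2 h3 ⊢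
    linarith
  · obtain ⟨j, rfl⟩ := Nat.exists_eq_add_of_le' (show 4 ≤ i by omega)
    have h0 := hdel (j + 2)
    have h1 := htop (j + 2) (by omega) (by omega)
    have h2 := hout (j + 3 : ℕ) (by omega)
    have h3 := hout (j + 4 : ℕ) (by omega)
    rw [show 2 * (a + 1) + m - 2 = j + 2 by omega]
    push_cast at h0 h1 h2 h3 ⊢
    ring_nf at h0 h1 h2 h3 ⊢
    linarith
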